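/- Let $1\to E\to \pi\to M\to 1$ be an exact sequence of groups, where $E$ is a surface group, i.e. isomorphic to the fundamental group of a compact connected orientable surface (possibly with boundary), and $M$ is torsion-free and elementary amenable. Here the class of elementary amenable groups is the smallest class of groups that contains all abelian and all finite groups and is closed under extensions and directed unions. Then $\pi$ has the $\mathcal{TEA}$-factorization property: for every epimorphism $\alpha\colon\pi\to G$ onto a finite group $G$ there exist a torsion-free elementary amenable group $\Gamma$, an epimorphism $\beta\colon\pi\to\Gamma$ and a homomorphism $\gamma\colon\Gamma\to G$ such that $\alpha=\gamma\circ\beta$. -/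

import Mathlib

universe u

/-- A group is torsion-free if its only element of finite order is the identity. (Mathlib's
`IsMulTorsionFree`, uniqueness of roots, is strictly stronger for non-abelian groups.) -/
def GroupTorsionFree (G : Type u) [Group G] : Prop :=
  ∀ g : G, IsOfFinOrder g → g = 1

/-- Elementary amenable groups: the smallest class of groups that contains all abelian and all
finite groups and is closed under extensions and directed unions. Taking the trivial group for `N`
in `extension` shows that the class is closed under isomorphism. -/
inductive ElementaryAmenable : ∀ (G : Type u) [Group G], Prop
  | of_abelian (G : Type u) [Group G] (h : ∀ a b : G, a * b = b * a) : ElementaryAmenable G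
  | of_finite (G : Type u) [Group G] (h : Finite G) : ElementaryAmenable G
  | extension (N G Q : Type u) [Group N] [Group G] [Group Q] (i : N →* G) (p : G →* Q)
      (hi : Function.Injective i) (hp : Function.Surjective p) (exact : i.range = p.ker)
      (hN : ElementaryAmenable N) (hQ : ElementaryAmenable Q) : ElementaryAmenable G
  | directed_union (G : Type u) [Group G] (S : Set (Subgroup G)) (hne : S.Nonempty)
      (hdir : DirectedOn (· ≤ ·) S) (hunion : ∀ g : G, ∃ H ∈ S, g ∈ H)
      (hS : ∀ H ∈ S, ElementaryAmenable H) : ElementaryAmenable G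

/-- The class of torsion-free elementary amenable groups. -/
def TEA (G : Type u) [Group G] : Prop :=
  GroupTorsionFree G ∧ ElementaryAmenable G

/-- The factorization property of a group `π` with respect to a class `P` of groups: every
epimorphism `α` from `π` onto a finite group factors as `γ ∘ β` through an epimorphism `β` from `π`
onto a group in `P`. (Both targets are quotients of `π`, so the universe of `π` suffices.) -/
def HasFactorizationProperty (P : ∀ (G : Type u) [Group G], Prop) (π : Type u) [Group π] : Prop :=
  ∀ (G : Type u) [Group G] [Finite G] (α : π →* G), Function.Surjective α →
    ∃ (Γ : Type u) (_ : Group Γ), P Γ ∧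
      ∃ (β : π →* Γ) (γ : Γ →* G), Function.Surjective β ∧ γ.comp β = α

/-- A simplicial complex is coherently orientable if each triangle `t` (face with three vertices)
can be given an orientation, i.e. a cyclic ordering `o t 0, o t 1, o t 2` of its vertices, such that
any two distinct triangles that share an edge induce opposite orientations on that edge. The
orientation of `t` orients its edges as `o t i → o t (i + 1)`, with `i + 1` taken mod 3. -/
def CoherentlyOrientable {V : Type*} [AddCommGroup V] [Module ℝ V]
    (K : Geometry.SimplicialComplex ℝ V) : Prop :=
  ∃ o : Finset V → Fin 3 → V,
    (∀ t ∈ K.faces, t.card = 3 → Set.range (o t) = (t : Set V)) ∧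
    ∀ t ∈ K.faces, ∀ t' ∈ K.faces, t.card = 3 → t'.card = 3 → t ≠ t' →
      ∀ i j : Fin 3, s(o t i, o t (i + 1)) = s(o t' j, o t' (j + 1)) →
        o t i = o t' (j + 1) ∧ o t (i + 1) = o t' j

/-- A (connected) compact orientable surface: a compact connected Hausdorff topological 2-manifold,
possibly with boundary, that is orientable in the sense that it has a triangulation whose triangles
can be coherently oriented. -/
structure IsCompactOrientableSurface (X : Type u) [TopologicalSpace X] : Prop where
  compact : CompactSpace X
  connected : ConnectedSpace X
  hausdorff : T2Space X
  manifold : Nonempty (ChartedSpace (EuclideanHalfSpace 2) X)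
  orientable : ∃ (n : ℕ) (K : Geometry.SimplicialComplex ℝ (EuclideanSpace ℝ (Fin n))),
    K.faces.Finite ∧ (∀ t ∈ K.faces, t.card ≤ 3) ∧ Nonempty (X ≃ₜ K.space) ∧ CoherentlyOrientable K

/-- A surface group: a group isomorphic to the fundamental group of a compact orientable surface.
(A compact surface embeds in a Euclidean space, so spaces in `Type` suffice.) -/
def IsSurfaceGroup (E : Type u) [Group E] : Prop :=
  ∃ (X : Type) (_ : TopologicalSpace X) (x : X),
    IsCompactOrientableSurface X ∧ Nonempty (E ≃* FundamentalGroup X x)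

/-! The theorem reduces to one property of a surface group `E`: each of its finite-index subgroups
has a torsion-free abelianization (`TorsionFreeAbelianizations`). Given an epimorphism `α` from `π`
to a finite group, let `A` be the intersection of its kernel with the image of `E`. The group
`Γ = π ⧸ ⁅A, A⁆` is an extension of `M` by a virtually abelian group, hence elementary amenable, and `α`
factors through it. A torsion element of `Γ` comes from some `e` in `E`. Let `F` be the kernel of
`α` on `E`. Since `F` and the subgroup generated by `F` and `e` have torsion-free abelianizations,
`e` lies first in `F` and then in `⁅F, F⁆`.

For a finite-index subgroup `H` of the fundamental group `G` of a triangulated surface, the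
abelianization of `H` is torsion-free as soon as all homomorphisms from `H` to `ℚ/ℤ` lift to `ℚ`
(`mem_commutator_of_pow_mem`). By Shapiro's lemma, this is a question about cocycles of `G` with
values in coinduced modules, that is, about lifting homomorphisms from `G` to semidirect products
(`exists_lift_of_coind_lift`). Such a homomorphism restricts to a cocycle on the edges of the
triangulation. Conversely, a lift of this cocycle glues trivial coverings of the open stars of the
vertices to a covering of the surface, whose monodromy is a lift of the homomorphism
(`exists_hom_lift`, `Geometry.SimplicialComplex.exists_hom_lift_of_edges`).

The obstruction to lifting the cocycle from `ℚ/ℤ` to `ℚ` is a torsion class in the second integral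
cohomology of the finite covering complex that corresponds to `H`, so it remains to see that this
cohomology has no torsion (`exists_integral_cochain`). Coherent orientability enters here: it makes
each edge belong to at most two triangles, which induce opposite orientations on it. -/

universe v w

/-! ### Elementary amenable groups and quotients by commutator subgroups -/

namespace ElementaryAmenable

/-- Elementary amenability is invariant under isomorphism, also across universes. In the inductive
step for extensions and unions, the pieces are realized as subgroups and quotients of `G'`, so that
they live in its universe. -/
theorem transfer {G : Type u} [Group G] (h : ElementaryAmenable G) :
    ∀ {G' : Type v} [Group G'], (G ≃* G') → ElementaryAmenable G' := by
  induction h with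
  | of_abelian G h =>
    intro G' _ e
    refine .of_abelian G' fun a b => e.symm.injective ?_
    rw [map_mul, map_mul, h]
  | of_finite G h =>
    intro G' _ e
    exact .of_finite G' (Finite.of_equiv G e.toEquiv)
  | extension N G Q i p hi hp exact hN hQ ihN ihQ =>
    intro G' _ e
    let p' : G' →* Q := p.comp e.symm.toMonoidHom
    have hp' : Function.Surjective p' := hp.comp e.symm.surjective
    let i' : N →* G' := e.toMonoidHom.comp i
    have hi' : Function.Injective i' := e.injective.comp hi
    have hrange : i'.range = p'.ker := by
      ext x
      have : e.symm x ∈ i.range ↔ e.symm x ∈ p.ker := by rw [exact]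
      simp only [MonoidHom.mem_range, MonoidHom.mem_ker] at this ⊢
      simp only [i', p', MonoidHom.comp_apply, MulEquiv.coe_toMonoidHom]
      rw [← this]
      simp only [MulEquiv.eq_symm_apply]
    have eN : N ≃* p'.ker := (MonoidHom.ofInjective hi').trans (MulEquiv.subgroupCongr hrange)
    have eQ : Q ≃* G' ⧸ p'.ker := (QuotientGroup.quotientKerEquivOfSurjective p' hp').symm
    exact .extension p'.ker G' (G' ⧸ p'.ker) p'.ker.subtype (QuotientGroup.mk' _)
      p'.ker.subtype_injective (QuotientGroup.mk'_surjective _) (by simp) (ihN eN) (ihQ eQ)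
  | directed_union G S hne hdir hunion hS ih =>
    intro G' _ e
    refine .directed_union G' (Subgroup.map e.toMonoidHom '' S) (hne.image _) ?_ ?_ ?_
    · rintro _ ⟨A, hA, rfl⟩ _ ⟨B, hB, rfl⟩
      obtain ⟨C, hC, hAC, hBC⟩ := hdir A hA B hB
      exact ⟨_, ⟨C, hC, rfl⟩, Subgroup.map_mono hAC, Subgroup.map_mono hBC⟩
    · intro g
      obtain ⟨H, hH, hg⟩ := hunion (e.symm g)
      exact ⟨_, ⟨H, hH, rfl⟩, e.symm g, hg, by simp⟩
    · rintro _ ⟨A, hA, rfl⟩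
      exact ih A hA (A.equivMapOfInjective e.toMonoidHom e.injective)

/-- An extension of an elementary amenable group, possibly in another universe, by an elementary
amenable kernel is elementary amenable. -/
theorem of_ker {G : Type u} {Q : Type v} [Group G] [Group Q] (p : G →* Q)
    (hp : Function.Surjective p) (hker : ElementaryAmenable p.ker) (hQ : ElementaryAmenable Q) :
    ElementaryAmenable G :=
  .extension p.ker G (G ⧸ p.ker) p.ker.subtype (QuotientGroup.mk' _) p.ker.subtype_injective
    (QuotientGroup.mk'_surjective _) (by simp) hker
    (hQ.transfer (QuotientGroup.quotientKerEquivOfSurjective p hp).symm)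

end ElementaryAmenable

/-- Every finite-index subgroup `H` of `G` has a torsion-free abelianization: an element of `H` with
a positive power in `⁅H, H⁆` lies in `⁅H, H⁆`. -/
def TorsionFreeAbelianizations (G : Type u) [Group G] : Prop :=
  ∀ H : Subgroup G, H.FiniteIndex → ∀ g ∈ H, ∀ n : ℕ, 0 < n → g ^ n ∈ ⁅H, H⁆ → g ∈ ⁅H, H⁆

theorem TorsionFreeAbelianizations.of_equiv {G : Type u} {G' : Type v} [Group G] [Group G']
    (e : G ≃* G') (h : TorsionFreeAbelianizations G') :
    TorsionFreeAbelianizations G := by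
  intro H hH g hg n hn hgn
  have hfi : (H.map e.toMonoidHom).FiniteIndex := by
    rw [show H.map e.toMonoidHom = _ from Subgroup.map_equiv_eq_comap_symm' e H]
    exact ⟨by rw [Subgroup.index_comap_of_surjective _ e.symm.surjective]; exact hH.1⟩
  have := h (H.map e.toMonoidHom) hfi (e g) ⟨g, hg, rfl⟩ n hn
    (by rw [← Subgroup.map_commutator]; exact ⟨g ^ n, hgn, by simp⟩)
  rw [← Subgroup.map_commutator] at this
  obtain ⟨g', hg', h'⟩ := this
  exact e.injective h' ▸ hg'

/-- The quotient `G ⧸ ⁅F, F⁆` by the commutator subgroup of a finite-index normal subgroup `F` is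
torsion-free: a torsion element is killed first in the abelianization of the subgroup generated by
`F` and the element, hence lies in `F`, and then in the abelianization of `F`. -/
theorem TorsionFreeAbelianizations.mem_commutator_ker {G : Type u} {Q : Type v} [Group G]
    [Group Q] [Finite Q] (hG : TorsionFreeAbelianizations G) (f : G →* Q) {g : G} {n : ℕ}
    (hn : 0 < n) (hgn : g ^ n ∈ ⁅f.ker, f.ker⁆) : g ∈ ⁅f.ker, f.ker⁆ := by
  -- the subgroup generated by the kernel and `g`: its image in `Q` is cyclic
  let H : Subgroup G := (Subgroup.zpowers (f g)).comap f
  have hfH : f.ker ≤ H := fun x hx => by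
    change f x ∈ Subgroup.zpowers (f g)
    rw [MonoidHom.mem_ker.1 hx]; exact one_mem _
  have hker : f.ker.FiniteIndex := by infer_instance
  have hH : H.FiniteIndex := Subgroup.finiteIndex_of_le hfH
  have h1 : g ∈ ⁅H, H⁆ := hG H hH g (Subgroup.mem_zpowers (f g)) n hn
    (Subgroup.commutator_mono hfH hfH hgn)
  have h2 : ⁅H, H⁆ ≤ f.ker := by
    rw [Subgroup.commutator_le]
    intro a ha b hb
    obtain ⟨j, hj⟩ := Subgroup.mem_zpowers_iff.1 (show f a ∈ Subgroup.zpowers (f g) from ha)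
    obtain ⟨k, hk⟩ := Subgroup.mem_zpowers_iff.1 (show f b ∈ Subgroup.zpowers (f g) from hb)
    rw [MonoidHom.mem_ker, map_commutatorElement, commutatorElement_eq_one_iff_mul_comm,
      ← hj, ← hk, ← zpow_add, ← zpow_add, add_comm]
  exact hG f.ker hker g (h2 h1) n hn hgn

/-- The quotient of `π` by the commutator subgroup of `A = p.ker ⊓ α.ker` is an extension of `M` by
`E ⧸ ⁅F, F⁆`, where `F` is the kernel of `α ∘ i`; both are torsion-free and elementary amenable. -/
theorem tea_quotient_commutator {E : Type u} {π : Type v} {M : Type w} [Group E] [Group π] [Group M]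
    (i : E →* π) (p : π →* M) (hp : Function.Surjective p)
    (hexact : i.range = p.ker) (hE : TorsionFreeAbelianizations E)
    (hi : Function.Injective i) (hM : TEA M)
    {G : Type v} [Group G] [Finite G] (α : π →* G) :
    TEA (π ⧸ ⁅p.ker ⊓ α.ker, p.ker ⊓ α.ker⁆) := by
  let A : Subgroup π := p.ker ⊓ α.ker
  have hNA : ⁅A, A⁆ ≤ A := Subgroup.commutator_le_left A A
  have hAp : A ≤ p.ker := inf_le_left
  constructor
  · intro x hx
    obtain ⟨g, rfl⟩ := QuotientGroup.mk_surjective x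
    obtain ⟨n, hn, hx⟩ := isOfFinOrder_iff_pow_eq_one.1 hx
    rw [← QuotientGroup.mk_pow, QuotientGroup.eq_one_iff] at hx
    rw [QuotientGroup.eq_one_iff]
    have hpg : p g = 1 := hM.1 _ (isOfFinOrder_iff_pow_eq_one.2 ⟨n, hn, by
      rw [← map_pow]; exact hAp (hNA hx)⟩)
    obtain ⟨e, rfl⟩ : g ∈ i.range := hexact ▸ hpg
    have hF : (α.comp i).ker.map i = p.ker ⊓ α.ker := by
      ext y
      constructor
      · rintro ⟨e, he, rfl⟩
        exact ⟨hexact ▸ ⟨e, rfl⟩, he⟩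
      · rintro ⟨h1, h2⟩
        obtain ⟨e, rfl⟩ : y ∈ i.range := hexact ▸ h1
        exact ⟨e, h2, rfl⟩
    rw [← hF, ← Subgroup.map_commutator] at hx ⊢
    obtain ⟨e', he', hee'⟩ := hx
    rw [← map_pow] at hee'
    exact ⟨e, hE.mem_commutator_ker _ hn (hi hee' ▸ he'), rfl⟩
  · -- `⁅A, A⁆ ≤ A ≤ p.ker ≤ π` has factors `A` abelianized, a finite group and `M`
    have h1 : ElementaryAmenable (π ⧸ A) := by
      refine .of_ker (QuotientGroup.lift A p hAp)
        (QuotientGroup.lift_surjective_of_surjective _ _ hp _) (.of_finite _ ?_) hM.2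
      refine Finite.of_injective (β := G)
        (fun x => QuotientGroup.lift A α (inf_le_right : A ≤ α.ker) x.1) ?_
      rintro ⟨x, hx⟩ ⟨y, hy⟩ hxy
      obtain ⟨x, rfl⟩ := QuotientGroup.mk_surjective x
      obtain ⟨y, rfl⟩ := QuotientGroup.mk_surjective y
      have hx : p x = 1 := hx
      have hy : p y = 1 := hy
      have hxy : α x = α y := hxy
      refine Subtype.ext (QuotientGroup.eq.2 ⟨?_, ?_⟩)
      · simp [hx, hy]
      · simp [hxy]
    refine .of_ker (QuotientGroup.lift ⁅A, A⁆ (QuotientGroup.mk' A) (by simpa using hNA))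
      (QuotientGroup.lift_surjective_of_surjective _ _ (QuotientGroup.mk'_surjective A) _)
      (.of_abelian _ ?_) h1
    rintro ⟨x, hx⟩ ⟨y, hy⟩
    obtain ⟨x, rfl⟩ := QuotientGroup.mk_surjective x
    obtain ⟨y, rfl⟩ := QuotientGroup.mk_surjective y
    have hx : x ∈ A := (QuotientGroup.eq_one_iff x).1 hx
    have hy : y ∈ A := (QuotientGroup.eq_one_iff y).1 hy
    have h2 : ((x * y * x⁻¹ * y⁻¹ : π) : π ⧸ ⁅A, A⁆) = 1 :=
      (QuotientGroup.eq_one_iff _).2 (Subgroup.commutator_mem_commutator hx hy)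
    exact Subtype.ext (commutatorElement_eq_one_iff_mul_comm.1 h2)

theorem factorization_of_torsionFreeAbelianizations
    {E : Type u} {π : Type v} {M : Type w} [Group E] [Group π] [Group M]
    (i : E →* π) (p : π →* M) (hi : Function.Injective i) (hp : Function.Surjective p)
    (hexact : i.range = p.ker) (hE : TorsionFreeAbelianizations E) (hM : TEA M) :
    HasFactorizationProperty TEA π := by
  intro G _ _ α _
  have hN : ⁅p.ker ⊓ α.ker, p.ker ⊓ α.ker⁆ ≤ α.ker :=
    (Subgroup.commutator_le_left _ _).trans inf_le_right
  exact ⟨π ⧸ ⁅p.ker ⊓ α.ker, p.ker ⊓ α.ker⁆, inferInstance,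
    tea_quotient_commutator i p hp hexact hE hi hM α, QuotientGroup.mk' _,
    QuotientGroup.lift _ α hN, QuotientGroup.mk'_surjective _, by ext; rfl⟩

/-! ### Integral cochains on oriented triangles -/

section Cochains

variable {D T : Type*} [Finite T]

/-- Let triangles `τ` have boundary edges `bd (τ, i)`, where no oriented edge occurs twice. If an
integer-valued function on the triangles is the coboundary of a rational antisymmetric cochain, then
it is the coboundary of an integral one. In other words, the cokernel of the integral coboundary has
no torsion. Two triangles with a common edge have the same class in the cokernel, and a triangle
with a free edge has class zero. For a nonzero class `a`, the edges of the triangles of class `a`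
therefore come in opposite pairs, so the values of a rational coboundary on them add up to zero. -/
theorem exists_integral_cochain (rev : D → D) (rev_rev : ∀ d, rev (rev d) = d)
    (rev_ne : ∀ d, rev d ≠ d) (bd : T × Fin 3 → D) (bd_inj : Function.Injective bd)
    (c : D → ℚ) (hc : ∀ d, c (rev d) = -c d) (z : T → ℤ)
    (hz : ∀ τ, ∑ i, c (bd (τ, i)) = z τ) :
    ∃ b : D → ℤ, (∀ d, b (rev d) = -b d) ∧ ∀ τ, ∑ i, b (bd (τ, i)) = z τ := by
  classical
  have := Fintype.ofFinite T
  let I : AddSubgroup (T → ℤ) :=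
    { carrier := {w | ∃ b : D → ℤ, (∀ d, b (rev d) = -b d) ∧ ∀ τ, ∑ i, b (bd (τ, i)) = w τ}
      zero_mem' := ⟨0, by simp, by simp⟩
      add_mem' := by
        rintro w w' ⟨b, hb, hw⟩ ⟨b', hb', hw'⟩
        refine ⟨b + b', fun d => by simp only [Pi.add_apply, hb, hb']; ring, fun τ => ?_⟩
        simp only [Pi.add_apply, Finset.sum_add_distrib, hw, hw']
      neg_mem' := by
        rintro w ⟨b, hb, hw⟩
        exact ⟨-b, fun d => by simp [hb], fun τ => by simp [← hw]⟩ }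
  let mk : (T → ℤ) →+ (T → ℤ) ⧸ I := QuotientAddGroup.mk' I
  -- `ε d` is the class in the cokernel of the triangle that contains `d`, if there is one
  let ε : D → (T → ℤ) ⧸ I := fun d => mk fun τ => ∑ i, if bd (τ, i) = d then 1 else 0
  have hε_rev : ∀ d, ε (rev d) = ε d := by
    intro d
    refine (QuotientAddGroup.eq (s := I)).2
      ⟨fun x => (if x = d then 1 else 0) - (if x = rev d then 1 else 0), fun x => ?_, fun τ => ?_⟩
    · have h1 : rev x = d ↔ x = rev d :=
        ⟨fun h => by rw [← h, rev_rev], fun h => by rw [h, rev_rev]⟩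
      have h2 : rev x = rev d ↔ x = d :=
        ⟨fun h => by rw [← rev_rev x, h, rev_rev], fun h => by rw [h]⟩
      simp only [h1, h2]
      ring
    · simp only [Finset.sum_sub_distrib, Pi.add_apply, Pi.neg_apply]
      ring
  have hε_bd : ∀ τ i, ε (bd (τ, i)) = mk (Pi.single τ 1) := by
    intro τ i
    refine congrArg mk (funext fun τ' => ?_)
    simp only [bd_inj.eq_iff, Prod.mk.injEq]
    rcases eq_or_ne τ' τ with rfl | h
    · simp
    · simp [h]
  have hε_zero : ∀ d, ε d ≠ 0 → d ∈ Finset.univ.image bd := by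
    intro d hd
    by_contra h
    refine hd ?_
    have : (fun τ => ∑ i, if bd (τ, i) = d then (1 : ℤ) else 0) = 0 := by
      funext τ
      refine Finset.sum_eq_zero fun i _ => if_neg fun h' => h ?_
      rw [← h']
      exact Finset.mem_image_of_mem _ (Finset.mem_univ _)
    change mk _ = 0
    rw [this, map_zero]
  have hfib : ∀ a : (T → ℤ) ⧸ I, a ≠ 0 → ∑ τ with mk (Pi.single τ 1) = a, z τ = 0 := by
    intro a ha
    have h0 : ∑ d ∈ (Finset.univ.image bd).filter (fun d => ε d = a), c d = 0 := by
      refine Finset.sum_involution (fun d _ => rev d) ?_ ?_ ?_ ?_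
      · intro d _
        rw [hc]; ring
      · intro d _ _
        exact rev_ne d
      · intro d hd
        rw [Finset.mem_filter] at hd ⊢
        have : ε (rev d) = a := by rw [hε_rev, hd.2]
        exact ⟨hε_zero _ (this ▸ ha), this⟩
      · intro d _
        exact rev_rev d
    rw [Finset.filter_image, Finset.sum_image bd_inj.injOn, Finset.sum_filter,
      Fintype.sum_prod_type] at h0
    simp only [hε_bd] at h0
    have : ((∑ τ with mk (Pi.single τ 1) = a, z τ : ℤ) : ℚ) = 0 := by
      rw [← h0, Finset.sum_filter, Int.cast_sum]
      refine Finset.sum_congr rfl fun τ _ => ?_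
      split_ifs
      · exact (hz τ).symm
      · simp
    exact_mod_cast this
  have hz0 : mk z = 0 := by
    have : z = ∑ τ, z τ • Pi.single (M := fun _ : T => ℤ) τ 1 := by
      funext τ
      simp [Finset.sum_apply, Pi.single_apply]
    rw [this, map_sum, ← Finset.sum_fiberwise_of_maps_to
      (g := fun τ => mk (Pi.single τ 1)) (t := Finset.univ.image fun τ => mk (Pi.single τ 1))
      (fun τ _ => Finset.mem_image_of_mem _ (Finset.mem_univ _))]
    refine Finset.sum_eq_zero fun a _ => ?_
    rw [Finset.sum_congr rfl (g := fun τ => z τ • a) (fun τ hτ => by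
      rw [map_zsmul, (Finset.mem_filter.1 hτ).2]), ← Finset.sum_smul]
    rcases eq_or_ne a 0 with rfl | ha
    · simp
    · rw [hfib a ha, zero_smul]
  exact (QuotientAddGroup.eq_zero_iff z).1 hz0

end Cochains

/-! ### Coinduced coefficients -/

section Coinduction

variable {G : Type u} [Group G] {A B : Type*} [CommGroup A] [CommGroup B]

/-- The semidirect product of `G` and the coinduced module `G ⧸ H → A`; its sections over `G` are
the `1`-cocycles of `G` with values in `G ⧸ H → A`. -/
abbrev Coind (H : Subgroup G) (A : Type*) [CommGroup A] : Type _ :=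
  (G ⧸ H → A) ⋊[mulAutArrow] G

/-- Change of coefficients along a homomorphism. -/
def Coind.map (H : Subgroup G) (f : A →* B) : Coind H A →* Coind H B :=
  SemidirectProduct.map (f.compLeft (G ⧸ H)) (MonoidHom.id G) fun g => by
    ext x s; rfl

theorem Coind.mul_left_apply {H : Subgroup G} (x y : Coind H A) (s : G ⧸ H) :
    (x * y).left s = x.left s * y.left (x.right⁻¹ • s) := rfl

theorem Coind.map_surjective (H : Subgroup G) (f : A →* B) (hf : Function.Surjective f) :
    Function.Surjective (Coind.map H f) := fun x =>
  ⟨⟨fun s => Function.surjInv hf (x.left s), x.right⟩,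
    SemidirectProduct.ext (funext fun s => Function.surjInv_eq hf (x.left s)) rfl⟩

theorem Coind.out_inv_mul_mem (H : Subgroup G) (g : G) (s : G ⧸ H) :
    s.out⁻¹ * g * (g⁻¹ • s).out ∈ H := by
  rw [mul_assoc]
  refine QuotientGroup.eq.1 ?_
  rw [QuotientGroup.out_eq', ← smul_eq_mul, ← MulAction.Quotient.smul_coe, QuotientGroup.out_eq',
    smul_inv_smul]

/-- The cocycle that corresponds to a homomorphism `φ : H →* B` under Shapiro's lemma, as a section
of `Coind H B → G`. The representatives of the cosets are `Quotient.out`. -/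
noncomputable def Coind.ofHom (H : Subgroup G) (φ : H →* B) : G →* Coind H B where
  toFun g := ⟨fun s => φ ⟨s.out⁻¹ * g * (g⁻¹ • s).out, Coind.out_inv_mul_mem H g s⟩, g⟩
  map_one' := by
    refine SemidirectProduct.ext (funext fun s => ?_) rfl
    change φ _ = 1
    rw [← map_one φ]
    congr 1
    ext
    simp
  map_mul' g h := by
    refine SemidirectProduct.ext (funext fun s => ?_) rfl
    rw [Coind.mul_left_apply]
    change φ _ = φ _ * φ _
    rw [← map_mul]
    congr 1
    ext
    simp only [Subgroup.coe_mul, mul_inv_rev, mul_smul]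
    group

/-- Reduction of coinduced coefficients from the rationals to the rationals modulo the integers. -/
abbrev Coind.reduce {G : Type*} [Group G] (H : Subgroup G) :
    Coind H (Multiplicative ℚ) →* Coind H (Multiplicative (AddCircle (1 : ℚ))) :=
  Coind.map H (QuotientAddGroup.mk' (AddSubgroup.zmultiples (1 : ℚ))).toMultiplicative

theorem Coind.inv_left_apply {G : Type*} [Group G] {H : Subgroup G} {A : Type*} [CommGroup A]
    (x : Coind H A) (s : G ⧸ H) : (x⁻¹).left s = (x.left (x.right • s))⁻¹ := by
  change (x.left (x.right⁻¹⁻¹ • s))⁻¹ = _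
  rw [inv_inv]

theorem Coind.reduce_surjective {G : Type*} [Group G] (H : Subgroup G) :
    Function.Surjective (Coind.reduce H) :=
  Coind.map_surjective H _ (QuotientAddGroup.mk'_surjective (AddSubgroup.zmultiples (1 : ℚ)))

/-- One direction of Shapiro's lemma: lifts of the coinduced cocycle yield lifts of `φ`, by
evaluation at the trivial coset, which `H` fixes. -/
theorem exists_lift_of_coind_lift {H : Subgroup G} (f : A →* B) (φ : H →* B)
    (ρ : G →* Coind H A) (hρ : (Coind.map H f).comp ρ = Coind.ofHom H φ) :
    ∃ ψ : H →* A, f.comp ψ = φ := by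
  have hright : ∀ g, (ρ g).right = g := fun g =>
    congrArg SemidirectProduct.right (DFunLike.congr_fun hρ g)
  have hfix : ∀ h : H, (h : G)⁻¹ • ((1 : G) : G ⧸ H) = ((1 : G) : G ⧸ H) := fun h =>
    QuotientGroup.eq.2 (by simp)
  refine ⟨⟨⟨fun h => (ρ h).left ((1 : G) : G ⧸ H), by simp⟩, fun h k => ?_⟩, ?_⟩
  · change (ρ (h * k)).left _ = (ρ h).left _ * (ρ k).left _
    rw [map_mul, Coind.mul_left_apply, hright, hfix]
  · ext h
    have := congrArg (fun x => x.left ((1 : G) : G ⧸ H)) (DFunLike.congr_fun hρ (h : G))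
    change f ((ρ h).left _) = φ h
    refine this.trans ?_
    have hmem : ((1 : G) : G ⧸ H).out ∈ H := by
      simpa using QuotientGroup.eq.1 (QuotientGroup.out_eq' ((1 : G) : G ⧸ H)).symm
    change φ _ = φ h
    have : φ ⟨_, Coind.out_inv_mul_mem H h ((1 : G) : G ⧸ H)⟩ =
        φ (⟨_, hmem⟩⁻¹ * h * ⟨_, hmem⟩) := by
      congr 1
      ext
      simp [hfix]
    rw [this, map_mul, map_mul, map_inv, mul_comm, mul_inv_cancel_left]

/-- If all characters of `H` with values in `ℚ/ℤ` lift to `ℚ`, then the abelianization of `H` is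
torsion-free: a torsion element is killed by all homomorphisms to `ℚ`, hence by all characters. -/
theorem mem_commutator_of_pow_mem {H : Subgroup G}
    (hlift : ∀ φ : H →* Multiplicative (AddCircle (1 : ℚ)), ∃ ψ : H →* Multiplicative ℚ,
      (QuotientAddGroup.mk' (AddSubgroup.zmultiples (1 : ℚ))).toMultiplicative.comp ψ = φ)
    {g : G} (hg : g ∈ H) {n : ℕ} (hn : 0 < n) (hgn : g ^ n ∈ ⁅H, H⁆) : g ∈ ⁅H, H⁆ := by
  rw [← Subgroup.map_subtype_commutator] at hgn ⊢
  obtain ⟨x, hx, hxg⟩ := hgn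
  obtain rfl : x = ⟨g, hg⟩ ^ n := Subtype.ext hxg
  refine ⟨⟨g, hg⟩, ?_, rfl⟩
  by_contra hne
  let a : Additive (Abelianization H) := Additive.ofMul (Abelianization.of ⟨g, hg⟩)
  have ha : a ≠ 0 := fun h => hne ((QuotientGroup.eq_one_iff _).1 h)
  obtain ⟨χ, hχ⟩ := CharacterModule.exists_character_apply_ne_zero_of_ne_zero ha
  let χ' : Additive (Abelianization H) →+ AddCircle (1 : ℚ) := χ
  obtain ⟨ψ, hψ⟩ := hlift (χ'.toMultiplicativeRight.comp Abelianization.of)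
  have h1 : ψ ⟨g, hg⟩ = 1 := by
    have : ψ (⟨g, hg⟩ ^ n) = 1 := Abelianization.commutator_subset_ker ψ hx
    rw [map_pow] at this
    have h0 : n • (ψ ⟨g, hg⟩).toAdd = 0 := congrArg Multiplicative.toAdd this
    exact congrArg Multiplicative.ofAdd ((smul_eq_zero.1 h0).resolve_left hn.ne')
  refine hχ ?_
  have := DFunLike.congr_fun hψ ⟨g, hg⟩
  rw [MonoidHom.comp_apply, h1, map_one] at this
  exact this.symm

end Coinduction

/-! ### Lifting homomorphisms through monodromy -/

section Monodromy

open Topology Filter unitInterval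

variable {X V W W' : Type*} [TopologicalSpace X]

/-- A continuous map into a bundle with discrete fibre is locally constant in the fibre
coordinate. -/
theorem FiberBundleCore.eventually_localTriv_snd_eq [TopologicalSpace W] [DiscreteTopology W]
    (Z : FiberBundleCore V X W) {Y : Type*} [TopologicalSpace Y] {Γ : Y → Z.TotalSpace}
    (hΓ : Continuous Γ) (t₀ : Y) (v : V) (hv : (Γ t₀).1 ∈ Z.baseSet v) :
    ∀ᶠ t in 𝓝 t₀, (Γ t).1 ∈ Z.baseSet v ∧
      (Z.localTriv v (Γ t)).2 = (Z.localTriv v (Γ t₀)).2 := by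
  have hcont : ContinuousAt (Z.localTriv v) (Γ t₀) :=
    (Z.localTriv v).continuousAt ((Z.mem_localTriv_source v _).2 hv)
  have h1 : Tendsto (fun t => (Z.localTriv v (Γ t)).2) (𝓝 t₀) (𝓝 (Z.localTriv v (Γ t₀)).2) :=
    (continuous_snd.continuousAt.comp hcont).comp hΓ.continuousAt
  have h2 : ∀ᶠ t in 𝓝 t₀, (Γ t).1 ∈ Z.baseSet v :=
    (Z.continuous_proj.comp hΓ).continuousAt.eventually ((Z.isOpen_baseSet v).mem_nhds hv)
  exact h2.and (h1.eventually ((isOpen_discrete {_}).mem_nhds rfl))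

variable [Group W] [Group W']

/-- The bundle with fibre `W` glued from the trivial bundles over `U v` by left multiplication with
the locally constant transition functions `g`. With the discrete topology on `W` it is a
covering. -/
def principalCore [TopologicalSpace W] [DiscreteTopology W] (U : V → Set X)
    (hU : ∀ v, IsOpen (U v)) (index : X → V) (hindex : ∀ x, x ∈ U (index x)) (g : V → V → W)
    (hg : ∀ u v w x, x ∈ U u → x ∈ U v → x ∈ U w → g u v * g v w = g u w) :
    FiberBundleCore V X W where
  baseSet := U
  isOpen_baseSet := hU
  indexAt := index
  mem_baseSet_at := hindex
  coordChange u v _ a := g v u * a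
  coordChange_self v x hx a := by
    have : g v v = 1 := by simpa using hg v v v x hx hx hx
    rw [this, one_mul]
  continuousOn_coordChange u v :=
    ((continuous_of_discreteTopology (f := fun a : W => g v u * a)).comp
      continuous_snd).continuousOn
  coordChange_comp u v w x hx a := by
    rw [← mul_assoc, hg w v u x hx.2 hx.1.2 hx.1.1]

/-- Let a homomorphism from the path classes of `X` to `W'` be trivialized over the sets `U v` of an
open cover by functions `h v`. If its transition functions `(h u)⁻¹ * h v` are constant and lift to
a cocycle `g` with values in `W`, then it lifts to `W` on the fundamental group. The lift is the
monodromy of the covering space glued by `g`; right multiplication by `W` commutes with the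
monodromy, and `h v x * q a` on the point of `U v × W` with coordinates `(x, a)` compares it with
the given homomorphism. -/
theorem exists_hom_lift (x₀ : X) (q : W →* W') (hq : Function.Surjective q) (U : V → Set X)
    (hU : ∀ v, IsOpen (U v)) (hcov : ∀ x, ∃ v, x ∈ U v)
    (Φ : ∀ {x y : X}, Path.Homotopic.Quotient x y → W')
    (hΦ : ∀ {x y z : X} (γ : Path.Homotopic.Quotient x y) (δ : Path.Homotopic.Quotient y z),
      Φ (γ.trans δ) = Φ δ * Φ γ)
    (h : V → X → W')
    (hloc : ∀ (v : V) {x y : X} (γ : Path x y), (∀ t, γ t ∈ U v) →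
      Φ (Path.Homotopic.Quotient.mk γ) = h v y * (h v x)⁻¹)
    (g : V → V → W) (hg : ∀ u v x, x ∈ U u → x ∈ U v → q (g u v) = (h u x)⁻¹ * h v x)
    (hcocycle : ∀ u v w x, x ∈ U u → x ∈ U v → x ∈ U w → g u v * g v w = g u w) :
    ∃ ρ : FundamentalGroup X x₀ →* W, ∀ γ : FundamentalGroup X x₀,
      q (ρ γ) = Φ (FundamentalGroup.toPath γ) := by
  let _ : TopologicalSpace W := ⊥
  have : DiscreteTopology W := ⟨rfl⟩
  choose index hindex using hcov
  let Z := principalCore U hU index hindex g hcocycle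
  have cov : IsCoveringMap Z.proj := FiberBundle.isCoveringMap (F := W) (E := Z.Fiber)
  let snd : Z.TotalSpace → W := fun p => p.2
  -- the difference of two lifts of a path is constant
  have hdiff : ∀ (Γ Δ : C(I, Z.TotalSpace)), (∀ t, (Γ t).1 = (Δ t).1) →
      (snd (Γ 0))⁻¹ * snd (Δ 0) = (snd (Γ 1))⁻¹ * snd (Δ 1) := by
    intro Γ Δ hΓΔ
    let f : I → W := fun t => (snd (Γ t))⁻¹ * snd (Δ t)
    have hf : IsLocallyConstant f := by
      refine (IsLocallyConstant.iff_eventually_eq f).2 fun t₀ => ?_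
      have key : ∀ t v, f t = (Z.localTriv v (Γ t)).2⁻¹ * (Z.localTriv v (Δ t)).2 := by
        intro t v
        change _ = (g v (index (Γ t).1) * snd (Γ t))⁻¹ * (g v (index (Δ t).1) * snd (Δ t))
        rw [hΓΔ t, mul_inv_rev, mul_assoc, inv_mul_cancel_left]
      filter_upwards [Z.eventually_localTriv_snd_eq Γ.continuous t₀ _ (hindex _),
        Z.eventually_localTriv_snd_eq Δ.continuous t₀ (index (Γ t₀).1)
          (by rw [← hΓΔ]; exact hindex _)] with t h1 h2
      rw [key t (index (Γ t₀).1), key t₀ (index (Γ t₀).1), h1.2, h2.2]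
    exact hf.apply_eq_of_preconnectedSpace 0 1
  -- independent of the chart, and multiplied by `Φ γ` along lifts of a path `γ`
  let F : Z.TotalSpace → W' := fun p => h (index p.1) p.1 * q p.2
  have hF : ∀ p v, p.1 ∈ U v → F p = h v p.1 * q (Z.localTriv v p).2 := by
    intro p v hv
    change h (index p.1) p.1 * q (snd p) = h v p.1 * q (g v (index p.1) * snd p)
    rw [map_mul, hg _ _ _ hv (hindex p.1)]
    group
  have hΦ_refl : ∀ x, Φ (Path.Homotopic.Quotient.mk (Path.refl x)) = 1 := by
    intro x
    rw [hloc (index x) (Path.refl x) (fun _ => hindex x), mul_inv_cancel]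
  have hΦ_cast : ∀ {x y x' y' : X} (γ : Path x y) (hx : x' = x) (hy : y' = y),
      Φ (Path.Homotopic.Quotient.mk (γ.cast hx hy)) = Φ (Path.Homotopic.Quotient.mk γ) := by
    rintro x y _ _ γ rfl rfl
    rfl
  have hlift : ∀ {x y : X} (γ : Path x y) (Γ : C(I, Z.TotalSpace)), (∀ t, (Γ t).1 = γ t) →
      F (Γ 1) = Φ (Path.Homotopic.Quotient.mk γ) * F (Γ 0) := by
    intro x y γ Γ hΓ
    let f : I → W' := fun t => (Φ (Path.Homotopic.Quotient.mk (γ.subpath 0 t)))⁻¹ * F (Γ t)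
    have hf : IsLocallyConstant f := by
      refine (IsLocallyConstant.iff_eventually_eq f).2 fun t₀ => ?_
      let v := index (γ t₀)
      have hmem : ∀ᶠ t in 𝓝 t₀, γ t ∈ U v :=
        γ.continuous.continuousAt.eventually ((hU v).mem_nhds (hindex _))
      have hIcc : ∀ᶠ t in 𝓝 t₀, Set.uIcc t₀ t ⊆ {t | γ t ∈ U v} :=
        (tendsto_const_nhds.uIcc tendsto_id : Tendsto (fun t => Set.uIcc t₀ t) (𝓝 t₀)
          (𝓝 t₀).smallSets).eventually (eventually_smallSets_subset.2 hmem)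
      filter_upwards [Z.eventually_localTriv_snd_eq Γ.continuous t₀ v
        (by rw [hΓ]; exact hindex _), hIcc] with t h1 h2
      have h3 : Φ (Path.Homotopic.Quotient.mk (γ.subpath t₀ t)) = h v (γ t) * (h v (γ t₀))⁻¹ := by
        refine hloc v _ fun s => ?_
        have : (γ.subpath t₀ t) s ∈ γ '' Set.uIcc t₀ t := by
          rw [← γ.range_subpath]; exact Set.mem_range_self s
        obtain ⟨s', hs', hss'⟩ := this
        rw [← hss']
        exact h2 hs'
      have h4 : Path.Homotopic.Quotient.mk (γ.subpath 0 t) =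
          (Path.Homotopic.Quotient.mk (γ.subpath 0 t₀)).trans
            (Path.Homotopic.Quotient.mk (γ.subpath t₀ t)) := by
        rw [← Path.Homotopic.Quotient.mk_trans]
        exact (Path.Homotopic.Quotient.eq.2 ⟨Path.Homotopy.subpathTransSubpath γ 0 t₀ t⟩).symm
      change (Φ _)⁻¹ * F _ = (Φ _)⁻¹ * F _
      rw [h4, hΦ, h3, hF (Γ t) v h1.1, hF (Γ t₀) v (by rw [hΓ]; exact hindex _), h1.2, hΓ, hΓ]
      group
    have h01 := hf.apply_eq_of_preconnectedSpace 0 1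
    simp only [f, Path.subpath_self, Path.subpath_zero_one, hΦ_refl, hΦ_cast] at h01
    rw [inv_one, one_mul] at h01
    rw [h01, mul_inv_cancel_left]
  -- the fibre over the base point is a copy of `W` on which the fundamental group acts
  let pt : W → Z.proj ⁻¹' {x₀} := fun a => ⟨⟨x₀, a⟩, rfl⟩
  let fib : Z.proj ⁻¹' {x₀} → W := fun p => p.1.2
  have hpt : ∀ p : Z.proj ⁻¹' {x₀}, pt (fib p) = p := by
    rintro ⟨⟨x, a⟩, hx⟩
    obtain rfl : x = x₀ := hx
    rfl
  have hfib : ∀ a, fib (pt a) = a := fun _ => rfl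
  have hmono : ∀ γ : FundamentalGroup X x₀, ∃ γ' : Path x₀ x₀,
      Path.Homotopic.Quotient.mk γ' = γ ∧ ∀ a : W, ∃ Γ : C(I, Z.TotalSpace),
        (∀ t, (Γ t).1 = γ' t) ∧ Γ 0 = pt a ∧ Γ 1 = cov.monodromyPerm x₀ γ (pt a) := by
    intro γ
    obtain ⟨γ', rfl⟩ := Path.Homotopic.Quotient.mk_surjective γ
    refine ⟨γ', rfl, fun a => ?_⟩
    have h0 : γ' 0 = Z.proj (pt a).1 := γ'.source
    exact ⟨cov.liftPath γ' (pt a) h0, fun t => congrFun (cov.liftPath_lifts γ' (pt a).1 h0) t,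
      cov.liftPath_zero γ' (pt a).1 h0, rfl⟩
  have hequiv : ∀ γ a, fib (cov.monodromyPerm x₀ γ (pt a)) =
      fib (cov.monodromyPerm x₀ γ (pt 1)) * a := by
    intro γ a
    obtain ⟨γ', -, hγ'⟩ := hmono γ
    obtain ⟨Γ, hΓ, hΓ0, hΓ1⟩ := hγ' 1
    obtain ⟨Δ, hΔ, hΔ0, hΔ1⟩ := hγ' a
    have := hdiff Γ Δ fun t => (hΓ t).trans (hΔ t).symm
    rw [hΓ0, hΓ1, hΔ0, hΔ1] at this
    change (1 : W)⁻¹ * a = (fib _)⁻¹ * fib _ at this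
    rw [inv_one, one_mul] at this
    exact (eq_inv_mul_iff_mul_eq.1 this).symm
  -- the monodromy gives `Φ` only up to conjugation by `h (index x₀) x₀`
  obtain ⟨k, hk⟩ := hq (h (index x₀) x₀)
  refine ⟨⟨⟨fun γ => k * fib (cov.monodromyPerm x₀ γ (pt 1)) * k⁻¹, ?_⟩, fun γ δ => ?_⟩,
    fun γ => ?_⟩
  · rw [map_one]
    change k * 1 * k⁻¹ = 1
    group
  · change k * _ * k⁻¹ = (k * _ * k⁻¹) * (k * _ * k⁻¹)
    rw [map_mul, Equiv.Perm.mul_apply, ← hpt (cov.monodromyPerm x₀ δ (pt 1)), hequiv, hfib]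
    group
  · obtain ⟨γ', rfl, hγ'⟩ := hmono γ
    obtain ⟨Γ, hΓ, hΓ0, hΓ1⟩ := hγ' 1
    have := hlift γ' Γ hΓ
    rw [hΓ0, hΓ1, ← hpt (cov.monodromyPerm x₀ _ (pt 1))] at this
    change h (index x₀) x₀ * q _ = _ * (h (index x₀) x₀ * q 1) at this
    rw [map_one, mul_one, ← hk] at this
    change q (k * _ * k⁻¹) = _
    rw [map_mul, map_mul, map_inv, mul_inv_eq_iff_eq_mul]
    exact this

end Monodromy

/-! ### The fundamental group of a finite simplicial complex -/

section SimplicialComplex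

open Topology Filter unitInterval

variable {V : Type*} [NormedAddCommGroup V] [NormedSpace ℝ V]

/-- Two paths with the same endpoints that run within a star-convex subset of `S` are homotopic in
`S`. -/
theorem Path.homotopic_of_starConvex {S A : Set V} {c : V} (hA : StarConvex ℝ c A) (hAS : A ⊆ S)
    {x y : S} (γ δ : Path x y) (hγ : ∀ t, (γ t : V) ∈ A) (hδ : ∀ t, (δ t : V) ∈ A) :
    γ.Homotopic δ := by
  have hx : (x : V) ∈ A := by simpa using hγ 0
  have hy : (y : V) ∈ A := by simpa using hγ 1
  have : ContractibleSpace A := hA.contractibleSpace ⟨x, hx⟩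
  let restrict (ε : Path x y) (hε : ∀ t, (ε t : V) ∈ A) : Path (⟨x, hx⟩ : A) ⟨y, hy⟩ :=
    { toFun := fun t => ⟨ε t, hε t⟩
      continuous_toFun := by fun_prop
      source' := by simp
      target' := by simp }
  exact (SimplyConnectedSpace.paths_homotopic (restrict γ hγ) (restrict δ hδ)).map
    ⟨Set.inclusion hAS, continuous_inclusion hAS⟩

/-- The straight path from `x` to `y`, for a segment contained in `S`. -/
def segmentPath {S : Set V} (x y : S) (h : segment ℝ (x : V) y ⊆ S) : Path x y where
  toFun t := ⟨AffineMap.lineMap (x : V) (y : V) (t : ℝ),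
    h (segment_eq_image_lineMap ℝ (x : V) y ▸ Set.mem_image_of_mem _ t.2)⟩
  continuous_toFun := by
    refine Continuous.subtype_mk ?_ _
    simp only [AffineMap.lineMap_apply]
    fun_prop
  source' := by simp
  target' := by simp

theorem segmentPath_mem {S : Set V} (x y : S) (h : segment ℝ (x : V) y ⊆ S) (t : I) :
    (segmentPath x y h t : V) ∈ segment ℝ (x : V) y :=
  segment_eq_image_lineMap ℝ (x : V) y ▸ Set.mem_image_of_mem _ t.2

theorem Path.trans_mem {X : Type*} [TopologicalSpace X] {x y z : X} (γ : Path x y) (δ : Path y z)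
    {A : Set X} (hγ : ∀ t, γ t ∈ A) (hδ : ∀ t, δ t ∈ A) (t : I) : γ.trans δ t ∈ A := by
  have : γ.trans δ t ∈ Set.range (γ.trans δ) := Set.mem_range_self t
  rw [Path.trans_range] at this
  rcases this with ⟨s, hs⟩ | ⟨s, hs⟩
  · exact hs ▸ hγ s
  · exact hs ▸ hδ s

namespace Geometry.SimplicialComplex

variable (K : Geometry.SimplicialComplex ℝ V)

/-- The open star of `v`: the points all of whose closed faces contain `v`. It is empty unless `v`
is a vertex. -/
def openStar (v : V) : Set K.space :=
  {x | ∀ t ∈ K.faces, (x : V) ∈ convexHull ℝ (t : Set V) → v ∈ t}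

variable {K}

theorem isOpen_openStar (hfin : K.faces.Finite) (v : V) : IsOpen (K.openStar v) := by
  have : (K.openStar v)ᶜ =
      ⋃ t ∈ {t ∈ K.faces | v ∉ t}, {x : K.space | (x : V) ∈ convexHull ℝ (t : Set V)} := by
    ext x
    simp only [openStar, Set.mem_compl_iff, Set.mem_ofPred_eq, Set.mem_iUnion, exists_prop]
    push Not
    exact ⟨fun ⟨t, h1, h2, h3⟩ => ⟨t, ⟨h1, h3⟩, h2⟩, fun ⟨t, ⟨h1, h3⟩, h2⟩ => ⟨t, h1, h2, h3⟩⟩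
  rw [← isClosed_compl_iff, this]
  refine (hfin.subset (Set.sep_subset _ _)).isClosed_biUnion fun t _ => ?_
  exact (t.finite_toSet.isClosed_convexHull ℝ).preimage continuous_subtype_val

theorem exists_face_of_openStar (x : K.space) :
    ∃ t ∈ K.faces, (x : V) ∈ convexHull ℝ (t : Set V) ∧ ∀ v, x ∈ K.openStar v → v ∈ t := by
  obtain ⟨t, ht, hx⟩ := mem_space_iff.1 x.2
  exact ⟨t, ht, hx, fun v hv => hv t ht hx⟩

/-- A point lies in the open stars of the vertices of the smallest face that contains it. -/
theorem exists_mem_openStar (x : K.space) : ∃ v : K.space, x ∈ K.openStar v := by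
  classical
  let P : ℕ → Prop := fun n => ∃ t ∈ K.faces, (x : V) ∈ convexHull ℝ (t : Set V) ∧ t.card = n
  have hP : ∃ n, P n := by
    obtain ⟨t, ht, hx⟩ := mem_space_iff.1 x.2
    exact ⟨_, t, ht, hx, rfl⟩
  obtain ⟨s, hs, hxs, hcard⟩ := Nat.find_spec hP
  obtain ⟨v, hv⟩ := nonempty_of_mem_faces hs
  refine ⟨⟨v, K.subset_space hs hv⟩, fun t ht hxt => ?_⟩
  have hmem := K.inter_subset_convexHull hs ht ⟨hxs, hxt⟩
  rw [← Finset.coe_inter] at hmem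
  have hne : (s ∩ t).Nonempty := by
    rw [← Finset.coe_nonempty, ← convexHull_nonempty_iff (𝕜 := ℝ)]
    exact ⟨_, hmem⟩
  have hle := Nat.find_min' hP
    ⟨s ∩ t, K.down_closed hs Finset.inter_subset_left hne, hmem, rfl⟩
  have : s ∩ t = s := Finset.eq_of_subset_of_card_le Finset.inter_subset_left (hcard ▸ hle)
  exact Finset.inter_eq_left.1 this hv

theorem segment_subset_convexHull_face {t : Finset V} {x y : V}
    (hx : x ∈ convexHull ℝ (t : Set V)) (hy : y ∈ convexHull ℝ (t : Set V)) :
    segment ℝ x y ⊆ convexHull ℝ (t : Set V) :=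
  (convex_convexHull ℝ _).segment_subset hx hy

theorem segment_subset_space {t : Finset V} (ht : t ∈ K.faces) {x y : V}
    (hx : x ∈ convexHull ℝ (t : Set V)) (hy : y ∈ convexHull ℝ (t : Set V)) :
    segment ℝ x y ⊆ K.space :=
  (segment_subset_convexHull_face hx hy).trans (convexHull_subset_space ht)

theorem segment_subset_space_of_openStar {v x : K.space} (hx : x ∈ K.openStar v) :
    segment ℝ (v : V) x ⊆ K.space := by
  obtain ⟨t, ht, hxt, h⟩ := exists_face_of_openStar x
  exact segment_subset_space ht (subset_convexHull ℝ _ (h v hx)) hxt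

theorem pathConnectedSpace (hfin : K.faces.Finite) [ConnectedSpace K.space] :
    PathConnectedSpace K.space := by
  have hconst : IsLocallyConstant (fun x : K.space => (ZerothHomotopy.mk x)) := by
    refine (IsLocallyConstant.iff_eventually_eq _).2 fun x => ?_
    obtain ⟨v, hv⟩ := exists_mem_openStar x
    have hjoin : ∀ y ∈ K.openStar v, ZerothHomotopy.mk v = ZerothHomotopy.mk y := fun y hy =>
      Quotient.sound ⟨segmentPath v y (segment_subset_space_of_openStar hy)⟩
    filter_upwards [(isOpen_openStar hfin (v : V)).mem_nhds hv] with y hy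
    exact (hjoin y hy).symm.trans (hjoin x hv)
  exact ⟨inferInstance, fun x y => Quotient.exact (hconst.apply_eq_of_preconnectedSpace x y)⟩

/-- A homomorphism `ρ` from the fundamental group to `W'` determines values `e u v` on the edges of
the complex, which satisfy the cocycle condition on the faces. If they lift to a cocycle `g` with
values in `W`, then `ρ` lifts to `W`. -/
theorem exists_hom_lift_of_edges (hfin : K.faces.Finite) [ConnectedSpace K.space] (x₀ : K.space)
    {W W' : Type*} [Group W] [Group W'] (q : W →* W') (hq : Function.Surjective q)
    (ρ : FundamentalGroup K.space x₀ →* W') :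
    ∃ e : K.space → K.space → W',
      (∀ t ∈ K.faces, ∀ u v w : K.space, (u : V) ∈ t → (v : V) ∈ t → (w : V) ∈ t →
        e u v * e v w = e u w) ∧
      ∀ g : K.space → K.space → W,
        (∀ t ∈ K.faces, ∀ u v : K.space, (u : V) ∈ t → (v : V) ∈ t → q (g u v) = e u v) →
        (∀ t ∈ K.faces, ∀ u v w : K.space, (u : V) ∈ t → (v : V) ∈ t → (w : V) ∈ t →
          g u v * g v w = g u w) →
        ∃ ρ' : FundamentalGroup K.space x₀ →* W, q.comp ρ' = ρ := by
  classical
  have := pathConnectedSpace hfin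
  -- paths from the base point, normalized to be trivial at the base point
  let r : ∀ x : K.space, Path.Homotopic.Quotient x₀ x := fun x =>
    (Path.Homotopic.Quotient.mk (PathConnectedSpace.somePath x₀ x₀)).symm.trans
      (Path.Homotopic.Quotient.mk (PathConnectedSpace.somePath x₀ x))
  have hr : r x₀ = .refl x₀ := Path.Homotopic.Quotient.symm_trans _
  let Φ : ∀ {x y : K.space}, Path.Homotopic.Quotient x y → W' := fun {x y} γ =>
    ρ (FundamentalGroup.fromPath (((r x).trans γ).trans (r y).symm))
  have hΦ : ∀ {x y z : K.space} (γ : Path.Homotopic.Quotient x y)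
      (δ : Path.Homotopic.Quotient y z), Φ (γ.trans δ) = Φ δ * Φ γ := by
    intro x y z γ δ
    simp only [Φ]
    rw [← map_mul, FundamentalGroup.mul_def]
    congr 1
    simp only [Path.Homotopic.Quotient.trans_assoc]
    congr 2
    rw [← Path.Homotopic.Quotient.trans_assoc (r y).symm, Path.Homotopic.Quotient.symm_trans,
      Path.Homotopic.Quotient.refl_trans]
  -- the value on the segment from `v` to `x`; used only for segments within the complex
  let h : K.space → K.space → W' := fun v x =>
    if hs : segment ℝ (v : V) x ⊆ K.space then
      Φ (Path.Homotopic.Quotient.mk (segmentPath v x hs)) else 1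
  have hh : ∀ (v x : K.space) (hs : segment ℝ (v : V) x ⊆ K.space),
      h v x = Φ (Path.Homotopic.Quotient.mk (segmentPath v x hs)) := fun v x hs => dif_pos hs
  have hface : ∀ t ∈ K.faces, ∀ x y z : K.space, (x : V) ∈ convexHull ℝ (t : Set V) →
      (y : V) ∈ convexHull ℝ (t : Set V) → (z : V) ∈ convexHull ℝ (t : Set V) →
      h y z * h x y = h x z := by
    intro t ht x y z hx hy hz
    rw [hh _ _ (segment_subset_space ht hy hz), hh _ _ (segment_subset_space ht hx hy),
      hh _ _ (segment_subset_space ht hx hz), ← hΦ, ← Path.Homotopic.Quotient.mk_trans]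
    congr 1
    refine Path.Homotopic.Quotient.eq.2 (Path.homotopic_of_starConvex
      ((convex_convexHull ℝ (t : Set V)).starConvex hx) (convexHull_subset_space ht) _ _
      (Path.trans_mem _ _ (A := {p : K.space | (p : V) ∈ convexHull ℝ (t : Set V)})
        (fun s => ?_) fun s => ?_) fun s => ?_)
    · exact segment_subset_convexHull_face hx hy (segmentPath_mem _ _ _ s)
    · exact segment_subset_convexHull_face hy hz (segmentPath_mem _ _ _ s)
    · exact segment_subset_convexHull_face hx hz (segmentPath_mem _ _ _ s)
  refine ⟨fun u v => h v u, fun t ht u v w hu hv hw => ?_, fun g hg hcocycle => ?_⟩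
  · exact hface t ht w v u (subset_convexHull ℝ _ hw) (subset_convexHull ℝ _ hv)
      (subset_convexHull ℝ _ hu)
  · have hloc : ∀ (v : K.space) {x y : K.space} (γ : Path x y), (∀ t, γ t ∈ K.openStar v) →
        Φ (Path.Homotopic.Quotient.mk γ) = h v y * (h v x)⁻¹ := by
      intro v x y γ hγ
      have hx : x ∈ K.openStar v := by simpa using hγ 0
      have hy : y ∈ K.openStar v := by simpa using hγ 1
      -- the set of points visible from `v`, which contains the open star
      let A : Set V := {z | segment ℝ (v : V) z ⊆ K.space}
      have hA : StarConvex ℝ (v : V) A := by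
        refine starConvex_iff_segment_subset.2 fun z hz z' hz' => ?_
        refine Set.Subset.trans ?_ (show segment ℝ (v : V) z ⊆ K.space from hz)
        exact (convex_segment (v : V) z).segment_subset (left_mem_segment ℝ _ _) hz'
      have hAS : A ⊆ K.space := fun z hz => hz (right_mem_segment ℝ _ _)
      have hstar : ∀ z ∈ K.openStar v, (z : V) ∈ A :=
        fun z hz => segment_subset_space_of_openStar hz
      have hseg : ∀ z ∈ K.openStar v, ∀ z' ∈ segment ℝ (v : V) z, z' ∈ A := fun z hz =>
        hA.segment_subset (hstar z hz)
      rw [eq_mul_inv_iff_mul_eq, hh v x (segment_subset_space_of_openStar hx),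
        hh v y (segment_subset_space_of_openStar hy), ← hΦ, ← Path.Homotopic.Quotient.mk_trans]
      congr 1
      refine Path.Homotopic.Quotient.eq.2 (Path.homotopic_of_starConvex hA hAS _ _
        (Path.trans_mem _ _ (A := {p : K.space | (p : V) ∈ A}) (fun s => ?_) fun s => ?_)
        fun s => ?_)
      · exact hseg x hx _ (segmentPath_mem _ _ _ s)
      · exact hstar _ (hγ s)
      · exact hseg y hy _ (segmentPath_mem _ _ _ s)
    obtain ⟨ρ', hρ'⟩ := exists_hom_lift x₀ q hq (fun v : K.space => K.openStar (v : V))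
      (fun v => isOpen_openStar hfin (v : V)) exists_mem_openStar Φ hΦ h hloc g
      (fun u v x hu hv => by
        obtain ⟨t, ht, hxt, hx⟩ := exists_face_of_openStar x
        rw [hg t ht u v (hx u hu) (hx v hv), eq_inv_mul_iff_mul_eq]
        exact hface t ht v u x (subset_convexHull ℝ _ (hx v hv))
          (subset_convexHull ℝ _ (hx u hu)) hxt)
      (fun u v w x hu hv hw => by
        obtain ⟨t, ht, -, hx⟩ := exists_face_of_openStar x
        exact hcocycle t ht u v w (hx u hu) (hx v hv) (hx w hw))
    refine ⟨ρ', MonoidHom.ext fun γ => (hρ' γ).trans ?_⟩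
    change ρ (((r x₀).trans γ).trans (r x₀).symm) = ρ γ
    congr 1
    rw [hr]
    change ((1 : FundamentalGroup K.space x₀)⁻¹ * (γ * 1)) = γ
    group

end Geometry.SimplicialComplex

end SimplicialComplex

/-! ### Coherently oriented complexes and surface groups -/

section OrientedSurface

theorem injective_of_range_eq_triangle {V : Type*} {t : Finset V} (ht : t.card = 3) {o : Fin 3 → V}
    (ho : Set.range o = (t : Set V)) : Function.Injective o := by
  classical
  have himage : Finset.univ.image o = t := by
    rw [← Finset.coe_inj, ← ho]
    simp
  have : (Finset.univ.image o).card = (Finset.univ : Finset (Fin 3)).card := by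
    rw [himage, ht]; rfl
  exact Set.injOn_univ.1 (by simpa using Finset.card_image_iff.1 this)

/-- For an antisymmetric `1`-cochain, the cocycle condition for one cyclic order of the vertices of
a triangle implies it for all triples of vertices. -/
theorem mul_eq_of_triangle {P W : Type*} [Group W] {g : P → P → W}
    (hinv : ∀ u v, g v u = (g u v)⁻¹) (hself : ∀ u, g u u = 1) (o : Fin 3 → P)
    (ho : g (o 0) (o 1) * g (o 1) (o 2) * g (o 2) (o 0) = 1) (i j k : Fin 3) :
    g (o i) (o j) * g (o j) (o k) = g (o i) (o k) := by
  have h02 : g (o 0) (o 2) = g (o 0) (o 1) * g (o 1) (o 2) := by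
    rw [hinv (o 2) (o 0)]
    exact (eq_inv_of_mul_eq_one_left ho).symm
  have h10 := hinv (o 0) (o 1)
  have h21 := hinv (o 1) (o 2)
  have h20 := hinv (o 0) (o 2)
  fin_cases i <;> fin_cases j <;> fin_cases k <;>
    simp [hself, h10, h21, h20, h02, mul_assoc]

variable {V : Type*} [NormedAddCommGroup V] [NormedSpace ℝ V]

namespace CoherentlyOrientable

variable {K : Geometry.SimplicialComplex ℝ V}

/-- On a coherently oriented complex of dimension at most two, a `1`-cocycle with values in the
coinduced module of `ℚ/ℤ` lifts to one with values in that of `ℚ`: the coboundary of an arbitrary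
lift is integral, and `exists_integral_cochain`, applied to the finite covering complex with fibre
`G ⧸ H`, corrects the lift by an integral cochain. Coherent orientability ensures that no
oriented edge is induced by two triangles. -/
theorem exists_cocycle_lift (hor : CoherentlyOrientable K) (hfin : K.faces.Finite)
    (hdim : ∀ t ∈ K.faces, t.card ≤ 3) {G : Type*} [Group G] (H : Subgroup G) [H.FiniteIndex]
    (e : K.space → K.space → Coind H (Multiplicative (AddCircle (1 : ℚ))))
    (he : ∀ t ∈ K.faces, ∀ u v w : K.space, (u : V) ∈ t → (v : V) ∈ t → (w : V) ∈ t →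
      e u v * e v w = e u w) :
    ∃ g : K.space → K.space → Coind H (Multiplicative ℚ),
      (∀ t ∈ K.faces, ∀ u v : K.space, (u : V) ∈ t → (v : V) ∈ t →
        Coind.reduce H (g u v) = e u v) ∧
      ∀ t ∈ K.faces, ∀ u v w : K.space, (u : V) ∈ t → (v : V) ∈ t → (w : V) ∈ t →
        g u v * g v w = g u w := by
  classical
  obtain ⟨o, ho, hopp⟩ := hor
  have he_self : ∀ t ∈ K.faces, ∀ u : K.space, (u : V) ∈ t → e u u = 1 := fun t ht u hu => by
    simpa using he t ht u u u hu hu hu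
  -- an arbitrary lift, antisymmetric by choosing a direction of each edge
  let _ : LinearOrder K.space := linearOrderOfSTO WellOrderingRel
  let lift := Function.surjInv (Coind.reduce_surjective H)
  have hlift : ∀ x, Coind.reduce H (lift x) = x := Function.surjInv_eq _
  let g₀ : K.space → K.space → Coind H (Multiplicative ℚ) := fun u v =>
    if u < v then lift (e u v) else if v < u then (lift (e v u))⁻¹ else 1
  have hg₀_self : ∀ u, g₀ u u = 1 := fun u => by simp [g₀]
  have hg₀_inv : ∀ u v, g₀ v u = (g₀ u v)⁻¹ := by
    intro u v
    rcases lt_trichotomy u v with h | rfl | h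
    · simp [g₀, h, h.not_gt]
    · simp [g₀]
    · simp [g₀, h, h.not_gt]
  have hg₀ : ∀ t ∈ K.faces, ∀ u v : K.space, (u : V) ∈ t → (v : V) ∈ t →
      Coind.reduce H (g₀ u v) = e u v := by
    intro t ht u v hu hv
    rcases lt_trichotomy u v with h | rfl | h
    · simp only [g₀, h, if_true, hlift]
    · rw [hg₀_self, map_one, he_self t ht u hu]
    · simp only [g₀, h, h.not_gt, if_true, if_false, map_inv, hlift]
      rw [inv_eq_iff_mul_eq_one, he t ht v u v hv hu hv, he_self t ht v hv]
  -- the oriented edges of the covering with fibre `G ⧸ H`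
  let D : Type _ := {d : K.space × K.space × (G ⧸ H) // d.1 ≠ d.2.1}
  let rev : D → D := fun d => ⟨(d.1.2.1, d.1.1, (g₀ d.1.1 d.1.2.1).right⁻¹ • d.1.2.2), d.2.symm⟩
  let c : D → ℚ := fun d => ((g₀ d.1.1 d.1.2.1).left d.1.2.2).toAdd
  have rev_rev : ∀ d, rev (rev d) = d := by
    rintro ⟨⟨u, v, s⟩, h⟩
    refine Subtype.ext (Prod.ext rfl (Prod.ext rfl ?_))
    change (g₀ v u).right⁻¹ • (g₀ u v).right⁻¹ • s = s
    rw [hg₀_inv u v, SemidirectProduct.inv_right, inv_inv, smul_inv_smul]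
  have rev_ne : ∀ d, rev d ≠ d := fun d h => d.2 (congrArg (fun d => d.1.2.1) h)
  have hc : ∀ d, c (rev d) = -c d := by
    rintro ⟨⟨u, v, s⟩, h⟩
    change ((g₀ v u).left ((g₀ u v).right⁻¹ • s)).toAdd = -((g₀ u v).left s).toAdd
    rw [hg₀_inv u v, Coind.inv_left_apply, smul_inv_smul, toAdd_inv]
  -- its triangles
  let T : Type _ := {t : Finset V // t ∈ K.faces ∧ t.card = 3}
  have : Finite T := (hfin.subset (Set.sep_subset K.faces fun t => t.card = 3)).to_subtype
  have : Finite (G ⧸ H) := Subgroup.finite_quotient_of_finiteIndex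
  have hmem : ∀ (t : T) i, o t.1 i ∈ t.1 := fun t i => by
    rw [← Finset.mem_coe, ← ho t.1 t.2.1 t.2.2]
    exact Set.mem_range_self i
  have hinj : ∀ t : T, Function.Injective (o t.1) := fun t =>
    injective_of_range_eq_triangle t.2.2 (ho t.1 t.2.1 t.2.2)
  let o' : T → Fin 3 → K.space := fun t i => ⟨o t.1 i, K.subset_space t.2.1 (hmem t i)⟩
  have hne : ∀ t i, o' t i ≠ o' t (i + 1) := by
    intro t i h
    have := hinj t (congrArg Subtype.val h)
    fin_cases i <;> simp at this
  let bd : (T × (G ⧸ H)) × Fin 3 → D := fun x =>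
    ⟨(o' x.1.1 x.2, o' x.1.1 (x.2 + 1), (g₀ (o' x.1.1 0) (o' x.1.1 x.2)).right⁻¹ • x.1.2),
      hne _ _⟩
  have bd_inj : Function.Injective bd := by
    rintro ⟨⟨t, s⟩, i⟩ ⟨⟨t', s'⟩, j⟩ h
    have h := Subtype.ext_iff.1 h
    have h1 : o t.1 i = o t'.1 j := congrArg (fun x => (x.1 : V)) h
    have h2 : o t.1 (i + 1) = o t'.1 (j + 1) := congrArg (fun x => (x.2.1 : V)) h
    have htt : t = t' := by
      by_contra hne'
      -- distinct triangles would induce opposite orientations on a common edge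
      have := (hopp t.1 t.2.1 t'.1 t'.2.1 t.2.2 t'.2.2 (fun h => hne' (Subtype.ext h)) i j
        (by rw [h1, h2])).1
      exact hne t i (Subtype.ext (this.trans h2.symm))
    subst htt
    obtain rfl := hinj t h1
    have h3 : (g₀ (o' t 0) (o' t i)).right⁻¹ • s = (g₀ (o' t 0) (o' t i)).right⁻¹ • s' :=
      congrArg (fun x => x.2.2) h
    rw [smul_left_cancel _ h3]
  have hred : ∀ t : T, Coind.reduce H
      (g₀ (o' t 0) (o' t 1) * g₀ (o' t 1) (o' t 2) * g₀ (o' t 2) (o' t 0)) = 1 := by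
    intro t
    have hm := hmem t
    rw [map_mul, map_mul, hg₀ t.1 t.2.1 _ _ (hm 0) (hm 1), hg₀ t.1 t.2.1 _ _ (hm 1) (hm 2),
      hg₀ t.1 t.2.1 _ _ (hm 2) (hm 0), he t.1 t.2.1 _ _ _ (hm 0) (hm 1) (hm 2),
      he t.1 t.2.1 _ _ _ (hm 0) (hm 2) (hm 0), he_self t.1 t.2.1 _ (hm 0)]
  have hright : ∀ t : T, (g₀ (o' t 0) (o' t 1)).right * (g₀ (o' t 1) (o' t 2)).right *
      (g₀ (o' t 2) (o' t 0)).right = 1 := fun t =>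
    congrArg SemidirectProduct.right (hred t)
  have hright02 : ∀ t : T, (g₀ (o' t 0) (o' t 2)).right =
      (g₀ (o' t 0) (o' t 1)).right * (g₀ (o' t 1) (o' t 2)).right := fun t => by
    rw [hg₀_inv (o' t 2) (o' t 0), SemidirectProduct.inv_right]
    exact (eq_inv_of_mul_eq_one_left (hright t)).symm
  have hsum : ∀ (f : D → ℚ) (t : T) s, ∑ i, f (bd ((t, s), i)) =
      f ⟨(o' t 0, o' t 1, s), hne t 0⟩ +
      f ⟨(o' t 1, o' t 2, (g₀ (o' t 0) (o' t 1)).right⁻¹ • s), hne t 1⟩ +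
      f ⟨(o' t 2, o' t 0,
        ((g₀ (o' t 0) (o' t 1)).right * (g₀ (o' t 1) (o' t 2)).right)⁻¹ • s), hne t 2⟩ := by
    intro f t s
    rw [Fin.sum_univ_three]
    congr 1
    · congr 1
      refine congrArg f (Subtype.ext (Prod.ext rfl (Prod.ext rfl ?_)))
      change (g₀ (o' t 0) (o' t 0)).right⁻¹ • s = s
      rw [hg₀_self, SemidirectProduct.one_right, inv_one, one_smul]
    · refine congrArg f (Subtype.ext (Prod.ext rfl (Prod.ext rfl ?_)))
      change (g₀ (o' t 0) (o' t 2)).right⁻¹ • s = _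
      rw [hright02]
  have hz : ∀ τ : T × (G ⧸ H), ∃ z : ℤ, ∑ i, c (bd (τ, i)) = z := by
    rintro ⟨t, s⟩
    have h0 : ((∑ i, c (bd ((t, s), i)) : ℚ) : AddCircle (1 : ℚ)) = 0 := by
      rw [hsum]
      exact congrFun (congrArg SemidirectProduct.left (hred t)) s
    obtain ⟨z, hz⟩ := (AddCircle.coe_eq_zero_iff (1 : ℚ)).1 h0
    exact ⟨z, by rw [← hz]; simp⟩
  choose z hz using hz
  obtain ⟨b, hb_rev, hb⟩ := exists_integral_cochain rev rev_rev rev_ne bd bd_inj c hc z hz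
  let b' : K.space → K.space → G ⧸ H → ℚ := fun u v s =>
    if h : u ≠ v then b ⟨(u, v, s), h⟩ else 0
  have hb' : ∀ u v s (h : u ≠ v), b' u v s = b ⟨(u, v, s), h⟩ := fun u v s h => dif_pos h
  let g : K.space → K.space → Coind H (Multiplicative ℚ) := fun u v =>
    ⟨fun s => Multiplicative.ofAdd (((g₀ u v).left s).toAdd - b' u v s), (g₀ u v).right⟩
  have hg_self : ∀ u, g u u = 1 := by
    intro u
    refine SemidirectProduct.ext (funext fun s => ?_) ?_
    · simp [g, b', hg₀_self]
    · simp [g, hg₀_self]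
  have hg_inv : ∀ u v, g v u = (g u v)⁻¹ := by
    intro u v
    rcases eq_or_ne u v with rfl | h
    · rw [hg_self, inv_one]
    refine SemidirectProduct.ext (funext fun s => ?_) ?_
    · rw [Coind.inv_left_apply]
      change Multiplicative.ofAdd (((g₀ v u).left s).toAdd - b' v u s) =
        (Multiplicative.ofAdd (((g₀ u v).left ((g₀ u v).right • s)).toAdd -
          b' u v ((g₀ u v).right • s)))⁻¹
      have hrev := hb_rev ⟨(u, v, (g₀ u v).right • s), h⟩
      have hrev' : rev ⟨(u, v, (g₀ u v).right • s), h⟩ = ⟨(v, u, s), h.symm⟩ :=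
        Subtype.ext (Prod.ext rfl (Prod.ext rfl (inv_smul_smul _ _)))
      rw [hrev'] at hrev
      rw [← ofAdd_neg, hg₀_inv u v, Coind.inv_left_apply, hb' v u s h.symm, hb' u v _ h, hrev,
        toAdd_inv]
      push_cast
      congr 1
      ring
    · rw [SemidirectProduct.inv_right]
      change (g₀ v u).right = (g₀ u v).right⁻¹
      rw [hg₀_inv u v, SemidirectProduct.inv_right]
  have htriangle : ∀ t : T,
      g (o' t 0) (o' t 1) * g (o' t 1) (o' t 2) * g (o' t 2) (o' t 0) = 1 := by
    intro t
    refine SemidirectProduct.ext (funext fun s => ?_) (hright t)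
    have h1 := hz (t, s)
    have h2 := congrArg (Int.cast : ℤ → ℚ) (hb (t, s))
    push_cast at h2
    rw [← h1, hsum c t s, hsum (fun d => (b d : ℚ)) t s, ← hb', ← hb', ← hb'] at h2
    refine congrArg Multiplicative.ofAdd
      (show (_ - b' (o' t 0) (o' t 1) s) + (_ - b' (o' t 1) (o' t 2) _) +
        (_ - b' (o' t 2) (o' t 0) _) = (0 : ℚ) from ?_)
    simp only [c] at h2
    linear_combination -h2
  refine ⟨g, fun t ht u v hu hv => ?_, fun t ht u v w hu hv hw => ?_⟩
  · rw [← hg₀ t ht u v hu hv]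
    refine SemidirectProduct.ext (funext fun s => ?_) rfl
    change ((((g₀ u v).left s).toAdd - b' u v s : ℚ) : AddCircle (1 : ℚ)) =
      ((((g₀ u v).left s).toAdd : ℚ) : AddCircle (1 : ℚ))
    have : ((b' u v s : ℚ) : AddCircle (1 : ℚ)) = 0 := by
      rcases eq_or_ne u v with h | h
      · simp [b', h]
      · rw [hb' u v s h]
        exact (AddCircle.coe_eq_zero_iff (1 : ℚ)).2 ⟨b ⟨(u, v, s), h⟩, by simp⟩
    rw [QuotientAddGroup.mk_sub, this, sub_zero]
  · by_cases hcard : t.card = 3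
    · have hvertex : ∀ u : K.space, (u : V) ∈ t → ∃ i, u = o' ⟨t, ht, hcard⟩ i := by
        intro u hu
        rw [← Finset.mem_coe, ← ho t ht hcard] at hu
        obtain ⟨i, hi⟩ := hu
        exact ⟨i, Subtype.ext hi.symm⟩
      obtain ⟨i, rfl⟩ := hvertex u hu
      obtain ⟨j, rfl⟩ := hvertex v hv
      obtain ⟨k, rfl⟩ := hvertex w hw
      exact mul_eq_of_triangle hg_inv hg_self _ (htriangle _) i j k
    · -- two of three vertices of an edge or a vertex coincide
      have hor : u = v ∨ v = w ∨ u = w := by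
        by_contra! hne
        refine hcard (le_antisymm (hdim t ht) ?_)
        rw [← Finset.card_eq_three.2 ⟨(u : V), (v : V), (w : V), fun h => hne.1 (Subtype.ext h),
          fun h => hne.2.2 (Subtype.ext h), fun h => hne.2.1 (Subtype.ext h), rfl⟩]
        refine Finset.card_le_card ?_
        simp [Finset.insert_subset_iff, hu, hv, hw]
      rcases hor with rfl | rfl | rfl
      · rw [hg_self, one_mul]
      · rw [hg_self, mul_one]
      · rw [hg_inv u v, mul_inv_cancel, hg_self]

/-- The fundamental group of a finite, connected, coherently oriented complex of dimension at most
two has torsion-free abelianizations of finite-index subgroups. -/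
theorem torsionFreeAbelianizations (hor : CoherentlyOrientable K) (hfin : K.faces.Finite)
    (hdim : ∀ t ∈ K.faces, t.card ≤ 3) [ConnectedSpace K.space] (x₀ : K.space) :
    TorsionFreeAbelianizations (FundamentalGroup K.space x₀) := by
  intro H hH g hg n hn hgn
  refine mem_commutator_of_pow_mem (fun φ => ?_) hg hn hgn
  obtain ⟨e, he, hlift⟩ := K.exists_hom_lift_of_edges hfin x₀ (Coind.reduce H)
    (Coind.reduce_surjective H) (Coind.ofHom H φ)
  obtain ⟨g', hg', hcocycle⟩ := hor.exists_cocycle_lift hfin hdim H e he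
  obtain ⟨ρ, hρ⟩ := hlift g' hg' hcocycle
  exact exists_lift_of_coind_lift _ φ ρ hρ

end CoherentlyOrientable

end OrientedSurface

/-- The isomorphism of fundamental groups induced by a homeomorphism. -/
noncomputable def fundamentalGroupHomeo {X Y : Type*} [TopologicalSpace X] [TopologicalSpace Y]
    (f : X ≃ₜ Y) (x : X) : FundamentalGroup X x ≃* FundamentalGroup Y (f x) :=
  MulEquiv.ofBijective (FundamentalGroup.map ⟨f, f.continuous⟩ x) <| by
    constructor
    · intro γ δ h
      obtain ⟨γ, rfl⟩ := Path.Homotopic.Quotient.mk_surjective γ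
      obtain ⟨δ, rfl⟩ := Path.Homotopic.Quotient.mk_surjective δ
      have h' : (γ.map f.continuous).Homotopic (δ.map f.continuous) :=
        Path.Homotopic.Quotient.eq.1 h
      refine Path.Homotopic.Quotient.eq.2 ?_
      have hmap := (h'.map ⟨f.symm, f.symm.continuous⟩)
      obtain ⟨F⟩ := hmap
      have hx : x = f.symm (f x) := (f.symm_apply_apply x).symm
      have hcast : ∀ ε : Path x x,
          ((ε.map f.continuous).map f.symm.continuous).cast hx hx = ε := fun ε => by
        ext t; simp
      rw [← hcast γ, ← hcast δ]
      exact ⟨F.cast rfl rfl⟩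
    · intro γ
      obtain ⟨γ, rfl⟩ := Path.Homotopic.Quotient.mk_surjective γ
      have hx : x = f.symm (f x) := (f.symm_apply_apply x).symm
      refine ⟨Path.Homotopic.Quotient.mk ((γ.map f.symm.continuous).cast hx hx), ?_⟩
      change Path.Homotopic.Quotient.mk _ = Path.Homotopic.Quotient.mk _
      congr 1
      ext t
      simp

theorem IsSurfaceGroup.torsionFreeAbelianizations {E : Type u} [Group E] (hE : IsSurfaceGroup E) :
    TorsionFreeAbelianizations E := by
  obtain ⟨X, _, x, hX, ⟨f⟩⟩ := hE
  obtain ⟨n, K, hfin, hdim, ⟨φ⟩, hor⟩ := hX.orientable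
  have := hX.connected
  have : ConnectedSpace K.space := φ.surjective.connectedSpace φ.continuous
  exact .of_equiv (f.trans (fundamentalGroupHomeo φ x))
    (hor.torsionFreeAbelianizations hfin hdim (φ x))

theorem proposition3p8 {E : Type*} {π : Type*} {M : Type*} [Group E] [Group π] [Group M]
    (i : E →* π) (p : π →* M) (hi : Function.Injective i) (hp : Function.Surjective p)
    (hexact : i.range = p.ker) (hE : IsSurfaceGroup E) (hM : TEA M) :
    HasFactorizationProperty TEA π :=
  factorization_of_torsionFreeAbelianizations i p hi hp hexact hE.torsionFreeAbelianizations hM
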